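/- For a function $f:\mathbb Z\to[0,\infty)$ with finite support $\{x_0<x_1<\dots<x_n\}$, let $f^{\#}:\mathbb Z\to[0,\infty)$ be given by $f^{\#}(r)=f(x_r)$ for $0\le r\le n$ and $f^{\#}(r)=0$ for all other integers $r$. Call $f$ \emph{$\#$-log-concave} if $f^{\#}(i)^2\ge f^{\#}(i-1)f^{\#}(i+1)$ for every $i\in\mathbb Z$. Let $f^{[i]}$ denote the $i$-th largest value of $f$, counted with multiplicity (so $f^{[i]}=0$ for $i>n+1$). For two such functions $f,g$, say that $f$ is \emph{majorized} by $g$, written $f\prec g$, if $\sum_{i=1}^k f^{[i]}\le\sum_{i=1}^k g^{[i]}$ for all $k\ge 1$ and $\sum_{i=1}^{M} f^{[i]}=\sum_{i=1}^{M} g^{[i]}$, where $M$ is the larger of the sizes of the two supports. Theorem. Let $N$ be a finite number and let $X_1,\dots,X_N$ be independent integer-valued random variables whose probability mass functions $f_1,\dots,f_N$ have finite support and are $\#$-log-concave. Let $X_1^{\#},\dots,X_N^{\#}$ be independent integer-valued random variables (possibly on another probability space) such that $X_j^{\#}$ has probability mass function $f_j^{\#}$ for each $j$. Then the probability mass functions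 of $X_1+\dots+X_N$ and of $X_1^{\#}+\dots+X_N^{\#}$ have finite support, and the former is majorized by the latter. -/

import Mathlib

/-- The probability mass function `x ↦ ℙ(X = x)` of an integer-valued random variable `X`. -/
noncomputable def massFn {Ω : Type*} [MeasurableSpace Ω] (μ : MeasureTheory.Measure Ω)
    (X : Ω → ℤ) (x : ℤ) : ℝ :=
  μ.real (X ⁻¹' {x})

/-- The squeezed rearrangement `f^#` of a finitely supported `f`: if the support of `f` is
`x₀ < ⋯ < xₙ`, then `f^# = ∑ r, f (x_r) • 𝟙_{r}`. -/
noncomputable def squeeze (f : ℤ → ℝ) (hf : (Function.support f).Finite) (k : ℤ) : ℝ :=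
  ∑ r : Fin hf.toFinset.card,
    Set.indicator {((r : ℕ) : ℤ)} (fun _ => f (hf.toFinset.orderEmbOfFin rfl r)) k

/-- Log-concavity of a sequence indexed by all integers. -/
def IsLogConcaveSeq (g : ℤ → ℝ) : Prop :=
  ∀ i : ℤ, g (i - 1) * g (i + 1) ≤ g i ^ 2

/-- A finitely supported function is `#`-log-concave if its squeezed rearrangement is
log-concave. -/
def IsHashLogConcave (f : ℤ → ℝ) (hf : (Function.support f).Finite) : Prop :=
  IsLogConcaveSeq (squeeze f hf)

/-- The nonzero values of a finitely supported function, with multiplicity, in decreasing order. -/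
noncomputable def sortedValues (f : ℤ → ℝ) (hf : (Function.support f).Finite) : List ℝ :=
  (hf.toFinset.val.map f).sort (· ≥ ·)

/-- The `i`-th largest value `f^{[i]}` (for `i = 1, 2, …`, counted with multiplicity) of a
nonnegative finitely supported function; it is `0` once the support is exhausted. -/
noncomputable def nthLargest (f : ℤ → ℝ) (hf : (Function.support f).Finite) (i : ℕ) : ℝ :=
  (sortedValues f hf).getD (i - 1) 0

/-- Majorization `f ≺ g` of nonnegative finitely supported functions on `ℤ`. The supports may have
different sizes; the shorter list of values is padded by zeros. -/
def Majorized (f g : ℤ → ℝ) : Prop :=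
  ∃ (hf : (Function.support f).Finite) (hg : (Function.support g).Finite),
    (∀ k : ℕ, ∑ i ∈ Finset.Icc 1 k, nthLargest f hf i ≤ ∑ i ∈ Finset.Icc 1 k, nthLargest g hg i) ∧
    ∑ i ∈ Finset.Icc 1 (max hf.toFinset.card hg.toFinset.card), nthLargest f hf i =
      ∑ i ∈ Finset.Icc 1 (max hf.toFinset.card hg.toFinset.card), nthLargest g hg i

/-!
Let `xⱼ` enumerate the support of `fⱼ` increasingly. Then `Xⱼ` has the law of `xⱼ(Xⱼ^#)`, so the
law of `∑ Xⱼ` is that of `S = ∑ xⱼ(Xⱼ^#)`, which lives on the same space as `R = ∑ Xⱼ^#`. The key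
claim is that `R` ranks the values of `S`: passing from `R = r` to `R = r + 1` moves the conditional
law of `S` to the right by at least one in stochastic order. For a single summand this says that
`xⱼ` is strictly increasing. It is preserved when an independent summand `Z` is added, because
log-concavity lets one couple the conditional laws of `R` given `R + Z = s` and given
`R + Z = s + 1` so that `R` stays put or grows by one; in the first case `Z` grows by one and in the
second case `R` does.

Consequently, for fixed `t`, the values of the conditional distribution functions of `S` given
`R = r` at `t - 1` and `t` bound intervals in `[0, 1]` that are disjoint for different `r`, so
`∑ r, ℙ(S = t | R = r) ≤ 1`. The conditional laws thus form a doubly substochastic kernel carrying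
the law of `R` to the law of `S`, and such kernels only lower the sums `∑ (f - c)⁺` that
characterize majorization.
-/

open Finset MeasureTheory ProbabilityTheory

section TotalPositivity

/-- Total positivity of order two of a kernel `K`: all its `2 × 2` minors are nonnegative. -/
def IsTP2 {α β : Type*} [Preorder α] [Preorder β] (K : α → β → ℝ) : Prop :=
  ∀ ⦃x x' y y'⦄, x ≤ x' → y ≤ y' → K x y' * K x' y ≤ K x y * K x' y'

/-- A Pólya frequency sequence of order two: a function on `ℤ` whose translation kernel is totally
positive of order two. For nonnegative functions this is log-concavity without internal zeros, the
form of log-concavity that survives convolution. -/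
def IsPF2 (f : ℤ → ℝ) : Prop :=
  IsTP2 fun x y => f (y - x)

theorem IsTP2.sum_mul {α β γ : Type*} [Preorder α] [LinearOrder β] [Preorder γ]
    {K : α → β → ℝ} {L : β → γ → ℝ} (hK : IsTP2 K) (hL : IsTP2 L) (T : Finset β) :
    IsTP2 fun x y => ∑ u ∈ T, K x u * L u y := by
  intro x x' y y' hx hy
  let D : β → β → ℝ := fun u v =>
    K x u * L u y * (K x' v * L v y') - K x u * L u y' * (K x' v * L v y)
  have symmetrized_nonneg : ∀ u v, 0 ≤ D u v + D v u := by
    intro u v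
    have hD : D u v + D v u =
        (K x u * K x' v - K x v * K x' u) * (L u y * L v y' - L u y' * L v y) := by
      simp only [D]
      ring
    rw [hD]
    rcases le_total u v with huv | huv
    · exact mul_nonneg (sub_nonneg.2 (hK hx huv)) (sub_nonneg.2 (hL huv hy))
    · refine mul_nonneg_of_nonpos_of_nonpos (sub_nonpos.2 (hK hx huv)) ?_
      linarith [hL huv hy]
  -- Exchanging the two summation indices turns the minor into a sum of products of minors.
  have hsum : 0 ≤ (∑ u ∈ T, ∑ v ∈ T, D u v) + ∑ u ∈ T, ∑ v ∈ T, D u v := by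
    nth_rw 2 [sum_comm]
    simp only [← sum_add_distrib]
    exact sum_nonneg fun u _ => sum_nonneg fun v _ => symmetrized_nonneg u v
  simp only [D, sum_sub_distrib, ← sum_mul_sum] at hsum
  linarith

theorem IsPF2.mul_le_mul {f : ℤ → ℝ} (hf : IsPF2 f) {p q x y : ℤ} (hpx : p ≤ x) (hpy : p ≤ y)
    (h : p + q = x + y) : f p * f q ≤ f x * f y := by
  have : f (q - 0) * f (x - (x - p)) ≤ f (x - 0) * f (q - (x - p)) := hf (by lia) (by lia)
  rwa [sub_zero, sub_zero, sub_sub_cancel, show q - (x - p) = y by lia, mul_comm (f q)] at this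

theorem IsPF2.ordConnected_support {f : ℤ → ℝ} (hf : IsPF2 f) (h0 : ∀ i, 0 ≤ f i) :
    (Function.support f).OrdConnected := by
  refine ⟨fun p hp q hq i hi => ?_⟩
  have hpq : 0 < f p * f q := mul_pos ((h0 p).lt_of_ne' hp) ((h0 q).lt_of_ne' hq)
  exact left_ne_zero_of_mul
    (hpq.trans_le (hf.mul_le_mul hi.1 (y := p + q - i) (by have := hi.2; lia) (by ring))).ne'

theorem IsLogConcaveSeq.mul_add_one_le {f : ℤ → ℝ} (hf : IsLogConcaveSeq f) (h0 : ∀ i, 0 ≤ f i)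
    (hconn : (Function.support f).OrdConnected) {p q : ℤ} (hpq : p ≤ q) :
    f p * f (q + 1) ≤ f (p + 1) * f q := by
  induction q, hpq using Int.leInduction with
  | base => rw [mul_comm]
  | succ q hpq ih =>
    rcases (h0 p).eq_or_lt with hp | hp
    · rw [← hp, zero_mul]
      exact mul_nonneg (h0 _) (h0 _)
    rcases (h0 (q + 1 + 1)).eq_or_lt with hq | hq
    · rw [← hq, mul_zero]
      exact mul_nonneg (h0 _) (h0 _)
    have hfq : 0 < f q := (h0 q).lt_of_ne' (hconn.out hp.ne' hq.ne' ⟨hpq, by lia⟩)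
    have hlc := hf (q + 1)
    rw [add_sub_cancel_right] at hlc
    refine le_of_mul_le_mul_left ?_ hfq
    calc f q * (f p * f (q + 1 + 1)) = f p * (f q * f (q + 1 + 1)) := by ring
      _ ≤ f p * f (q + 1) ^ 2 := mul_le_mul_of_nonneg_left hlc hp.le
      _ = (f p * f (q + 1)) * f (q + 1) := by ring
      _ ≤ (f (p + 1) * f q) * f (q + 1) := mul_le_mul_of_nonneg_right ih (h0 _)
      _ = f q * (f (p + 1) * f (q + 1)) := by ring

theorem IsLogConcaveSeq.isPF2 {f : ℤ → ℝ} (hf : IsLogConcaveSeq f) (h0 : ∀ i, 0 ≤ f i)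
    (hconn : (Function.support f).OrdConnected) : IsPF2 f := by
  have shift_le : ∀ (d : ℕ) (p y : ℤ), p + d ≤ y → f p * f (y + d) ≤ f (p + d) * f y := by
    intro d
    induction d with
    | zero => simp
    | succ d ih =>
      intro p y hy
      have h1 := ih p (y + 1) (by lia)
      have h2 := hf.mul_add_one_le h0 hconn (p := p + d) (q := y) (by lia)
      rw [show y + ((d + 1 : ℕ) : ℤ) = y + 1 + d by lia,
        show p + ((d + 1 : ℕ) : ℤ) = p + d + 1 by lia]
      exact h1.trans h2
  intro x x' y y' hx hy
  obtain ⟨a, rfl⟩ := Int.le.dest hx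
  obtain ⟨b, rfl⟩ := Int.le.dest hy
  change f (y + b - x) * f (y - (x + a)) ≤ f (y - x) * f (y + b - (x + a))
  have hya : y - (x + a) + a = y - x := by ring
  have hyb : y - (x + a) + b = y + b - (x + a) := by ring
  have hyab : y - x + b = y + b - x := by ring
  have hyba : y + b - (x + a) + a = y + b - x := by ring
  rcases le_total a b with hab | hab
  · have := shift_le a (y - (x + a)) (y + b - (x + a)) (by lia)
    rwa [hya, hyba, mul_comm (f (y - (x + a)))] at this
  · have := shift_le b (y - (x + a)) (y - x) (by lia)
    rwa [hyb, hyab, mul_comm (f (y - (x + a))), mul_comm (f (y + b - (x + a)))] at this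

end TotalPositivity

section Coupling

theorem sum_range_mul_sum_range_le {a b : ℕ → ℝ} {r M : ℕ} (hr : r ≤ M)
    (h : ∀ p q, p < q → b p * a q ≤ a p * b q) :
    (∑ i ∈ range r, b i) * ∑ i ∈ range M, a i ≤ (∑ i ∈ range r, a i) * ∑ i ∈ range M, b i := by
  have cross : (∑ i ∈ range r, b i) * ∑ i ∈ Ico r M, a i ≤
      (∑ i ∈ range r, a i) * ∑ i ∈ Ico r M, b i := by
    rw [sum_mul_sum, sum_mul_sum]
    exact sum_le_sum fun p hp => sum_le_sum fun q hq =>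
      h p q ((mem_range.1 hp).trans_le (mem_Ico.1 hq).1)
  rw [← sum_range_add_sum_Ico a hr, ← sum_range_add_sum_Ico b hr]
  linarith

/-- `IsAdjacentCoupling a b M stay move` says that `a₀, …, a_{M-1}` and `b₀, …, b_M`, normalized to
equal total mass, are coupled by matching each index `r` with `r` (mass `stay r`) or with `r + 1`
(mass `move (r + 1)`). -/
structure IsAdjacentCoupling (a b : ℕ → ℝ) (M : ℕ) (stay move : ℕ → ℝ) : Prop where
  stay_nonneg : ∀ r ≤ M, 0 ≤ stay r
  move_nonneg : ∀ r ≤ M, 0 ≤ move r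
  stay_add_move_succ : ∀ r, stay r + move (r + 1) = a r * ∑ i ∈ range (M + 1), b i
  stay_add_move : ∀ r, stay r + move r = b r * ∑ i ∈ range M, a i
  stay_last : stay M = 0
  move_zero : move 0 = 0

theorem exists_isAdjacentCoupling {a b : ℕ → ℝ} (M : ℕ) (ha : ∀ r, 0 ≤ a r) (hb : ∀ r, 0 ≤ b r)
    (hab : ∀ p q, p < q → b p * a q ≤ a p * b q)
    (hba : ∀ p q, p < q → a p * b (q + 1) ≤ b (p + 1) * a q) :
    ∃ stay move, IsAdjacentCoupling a b M stay move := by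
  set A := ∑ r ∈ range M, a r
  set B := ∑ r ∈ range (M + 1), b r with hB
  let move : ℕ → ℝ := fun r => (∑ i ∈ range r, a i) * B - (∑ i ∈ range r, b i) * A
  let stay : ℕ → ℝ := fun r => b r * A - move r
  refine ⟨stay, move, fun r hr => ?_, fun r hr => ?_, fun r => ?_, fun r => sub_add_cancel _ _,
    ?_, by simp [move]⟩
  · have h := sum_range_mul_sum_range_le (a := fun i => b (i + 1)) hr hba
    have hle : ∑ i ∈ range r, a i ≤ A :=
      sum_le_sum_of_subset_of_nonneg (range_mono hr) fun _ _ _ => ha _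
    have hb_zero := mul_le_mul_of_nonneg_right hle (hb 0)
    have hsucc : (∑ i ∈ range r, b (i + 1)) + b 0 = (∑ i ∈ range r, b i) + b r := by
      rw [← sum_range_succ', sum_range_succ]
    simp only [stay, move, hB, sum_range_succ']
    linear_combination h + hb_zero + A * hsucc
  · have h := sum_range_mul_sum_range_le hr hab
    have hA_r : 0 ≤ ∑ i ∈ range r, a i := sum_nonneg fun _ _ => ha _
    have := mul_nonneg hA_r (hb M)
    simp only [move, hB, sum_range_succ]
    linarith
  · simp only [stay, move, hB, sum_range_succ]
    ring
  · simp only [stay, move, hB, sum_range_succ]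
    ring

theorem IsAdjacentCoupling.sum_mul_sum_le {a b stay move u v : ℕ → ℝ} {M : ℕ}
    (h : IsAdjacentCoupling a b M stay move) (huv : ∀ r, a r ≠ 0 → b r ≠ 0 → v r ≤ u r)
    (huv_succ : ∀ r, a r ≠ 0 → b (r + 1) ≠ 0 → v (r + 1) ≤ u r) :
    (∑ r ∈ range (M + 1), b r * v r) * ∑ r ∈ range M, a r ≤
      (∑ r ∈ range M, a r * u r) * ∑ r ∈ range (M + 1), b r := by
  have stay_mul_le : ∀ r < M, stay r * v r ≤ stay r * u r := by
    intro r hr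
    rcases (h.stay_nonneg r hr.le).eq_or_lt with hs | hs
    · rw [← hs, zero_mul, zero_mul]
    · have ha_mul := hs.trans_le (le_add_of_nonneg_right (h.move_nonneg (r + 1) hr))
      have hb_mul := hs.trans_le (le_add_of_nonneg_right (h.move_nonneg r hr.le))
      rw [h.stay_add_move_succ] at ha_mul
      rw [h.stay_add_move] at hb_mul
      exact mul_le_mul_of_nonneg_left
        (huv r (left_ne_zero_of_mul ha_mul.ne') (left_ne_zero_of_mul hb_mul.ne')) hs.le
  have move_mul_le : ∀ r < M, move (r + 1) * v (r + 1) ≤ move (r + 1) * u r := by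
    intro r hr
    rcases (h.move_nonneg (r + 1) hr).eq_or_lt with hm | hm
    · rw [← hm, zero_mul, zero_mul]
    · have ha_mul := hm.trans_le (le_add_of_nonneg_left (h.stay_nonneg r hr.le))
      have hb_mul := hm.trans_le (le_add_of_nonneg_left (h.stay_nonneg (r + 1) hr))
      rw [h.stay_add_move_succ] at ha_mul
      rw [h.stay_add_move] at hb_mul
      exact mul_le_mul_of_nonneg_left
        (huv_succ r (left_ne_zero_of_mul ha_mul.ne') (left_ne_zero_of_mul hb_mul.ne')) hm.le
  calc (∑ r ∈ range (M + 1), b r * v r) * ∑ r ∈ range M, a r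
      = ∑ r ∈ range (M + 1), (stay r * v r + move r * v r) := by
        rw [sum_mul]
        exact sum_congr rfl fun r _ => by rw [← add_mul, h.stay_add_move]; ring
    _ = ∑ r ∈ range M, (stay r * v r + move (r + 1) * v (r + 1)) := by
        rw [sum_add_distrib, sum_add_distrib, sum_range_succ, h.stay_last, sum_range_succ',
          h.move_zero]
        simp
    _ ≤ ∑ r ∈ range M, (stay r * u r + move (r + 1) * u r) :=
        sum_le_sum fun r hr =>
          add_le_add (stay_mul_le r (mem_range.1 hr)) (move_mul_le r (mem_range.1 hr))
    _ = (∑ r ∈ range M, a r * u r) * ∑ r ∈ range (M + 1), b r := by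
        rw [sum_mul]
        exact sum_congr rfl fun r _ => by rw [← add_mul, h.stay_add_move_succ]; ring

theorem sum_sub_le_of_disjoint_intervals {ι : Type*} [LinearOrder ι] (T : Finset ι) {u v : ι → ℝ}
    {c d : ℝ} (hcd : c ≤ d) (hv : ∀ i ∈ T, c ≤ v i) (hu : ∀ i ∈ T, u i ≤ d)
    (huv : ∀ i ∈ T, ∀ j ∈ T, i < j → u j ≤ v i) : ∑ i ∈ T, (u i - v i) ≤ d - c := by
  induction T using Finset.induction_on_max generalizing c with
  | empty => simpa using hcd
  | insert m T hm ih =>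
    rw [sum_insert fun hmT => (hm m hmT).false]
    have below : ∑ i ∈ T, (u i - v i) ≤ d - u m := by
      refine ih (hu m (mem_insert_self _ _)) (fun i hi => ?_) (fun i hi => ?_) fun i hi j hj => ?_
      · exact huv i (mem_insert_of_mem hi) m (mem_insert_self _ _) (hm i hi)
      · exact hu i (mem_insert_of_mem hi)
      · exact huv i (mem_insert_of_mem hi) j (mem_insert_of_mem hj)
    linarith [hv m (mem_insert_self _ _)]

theorem IsPF2.exists_isAdjacentCoupling {f g : ℤ → ℝ} (hf : IsPF2 f) (hg : IsPF2 g)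
    (hf0 : ∀ i, 0 ≤ f i) (hg0 : ∀ i, 0 ≤ g i) (s : ℤ) (M : ℕ) :
    ∃ stay move, IsAdjacentCoupling (fun r => f r * g (s - r)) (fun r => f r * g (s + 1 - r)) M
      stay move := by
  refine _root_.exists_isAdjacentCoupling M (fun r => mul_nonneg (hf0 _) (hg0 _))
    (fun r => mul_nonneg (hf0 _) (hg0 _)) (fun p q hpq => ?_) fun p q hpq => ?_
  · have hgpq : g (s - q) * g (s + 1 - p) ≤ g (s - p) * g (s + 1 - q) :=
      hg.mul_le_mul (by lia) (by lia) (by ring)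
    linarith [mul_le_mul_of_nonneg_left hgpq (mul_nonneg (hf0 p) (hf0 q))]
  · have hfpq : f p * f (q + 1) ≤ f (p + 1) * f q :=
      hf.mul_le_mul (by lia) (by lia) (by ring)
    push_cast
    simp only [add_sub_add_right_eq_sub]
    linarith [mul_le_mul_of_nonneg_left hfpq (mul_nonneg (hg0 (s - p)) (hg0 (s - q)))]

theorem IsPF2.sum_conv_mul_le {f g : ℤ → ℝ} (hf : IsPF2 f) (hg : IsPF2 g)
    (hf0 : ∀ i, 0 ≤ f i) (hg0 : ∀ i, 0 ≤ g i) {F : ℤ → ℤ → ℝ} (hF : ∀ r, Monotone (F r))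
    (hF_succ : ∀ r t, f r ≠ 0 → f (r + 1) ≠ 0 → F (r + 1) (t + 1) ≤ F r t) {x : ℤ → ℤ}
    (hx : StrictMonoOn x (Function.support g)) (s t : ℤ) (M : ℕ) :
    (∑ r ∈ range (M + 1), f r * g (s + 1 - r) * F r (t + 1 - x (s + 1 - r))) *
        ∑ r ∈ range M, f r * g (s - r) ≤
      (∑ r ∈ range M, f r * g (s - r) * F r (t - x (s - r))) *
        ∑ r ∈ range (M + 1), f r * g (s + 1 - r) := by
  obtain ⟨stay, move, hcoupling⟩ := hf.exists_isAdjacentCoupling hg hf0 hg0 s M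
  refine hcoupling.sum_mul_sum_le (fun r ha hb => hF r ?_) fun r ha hb => ?_
  · have := hx (right_ne_zero_of_mul ha) (right_ne_zero_of_mul hb) (by lia)
    lia
  · push_cast at hb ⊢
    rw [add_sub_add_right_eq_sub, add_sub_right_comm]
    exact hF_succ r _ (left_ne_zero_of_mul ha) (left_ne_zero_of_mul hb)

end Coupling

section Majorization

theorem sum_take_le {c : ℝ} (hc : 0 ≤ c) (l : List ℝ) (k : ℕ) :
    (l.take k).sum ≤ k * c + (l.map fun x => (x - c)⁺).sum := by
  induction l generalizing k with
  | nil => simpa using mul_nonneg k.cast_nonneg hc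
  | cons x l ih =>
    cases k with
    | zero =>
      simpa using List.sum_nonneg (l := (x :: l).map fun x => (x - c)⁺) (by simp)
    | succ k =>
      simp only [List.take_succ_cons, List.sum_cons, List.map_cons]
      push_cast
      linarith [ih k, le_posPart (x - c)]

theorem getD_of_forall_mem {α : Type*} {P : α → Prop} {l : List α} {d : α} (hd : P d)
    (hl : ∀ x ∈ l, P x) (k : ℕ) : P (l.getD k d) := by
  rcases lt_or_ge k l.length with hk | hk
  · rw [List.getD_eq_getElem l d hk]
    exact hl _ (List.getElem_mem hk)
  · rwa [List.getD_eq_default l d hk]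

theorem sum_take_of_pairwise_ge {l : List ℝ} (hl : l.Pairwise (· ≥ ·)) (h0 : ∀ x ∈ l, 0 ≤ x)
    (k : ℕ) :
    (l.take k).sum = k * l.getD k 0 + (l.map fun x => (x - l.getD k 0)⁺).sum := by
  induction l generalizing k with
  | nil => simp
  | cons x l ih =>
    obtain ⟨hx, hl⟩ := List.pairwise_cons.1 hl
    have hl0 : ∀ y ∈ l, 0 ≤ y := fun y hy => h0 y (List.mem_cons_of_mem x hy)
    cases k with
    | zero =>
      have hzero : (l.map fun y => (y - x)⁺).sum = 0 :=
        List.sum_eq_zero (by simpa using hx)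
      simp [hzero]
    | succ k =>
      have hle : l.getD k 0 ≤ x :=
        getD_of_forall_mem (P := (· ≤ x)) (h0 x List.mem_cons_self) hx k
      simp only [List.take_succ_cons, List.sum_cons, List.map_cons, List.getD_cons_succ,
        posPart_eq_self.2 (sub_nonneg.2 hle), ih hl hl0 k]
      push_cast
      ring

theorem sum_range_getD (l : List ℝ) (k : ℕ) : ∑ i ∈ range k, l.getD i 0 = (l.take k).sum := by
  induction k generalizing l with
  | zero => simp
  | succ k ih =>
    cases l with
    | nil => simp
    | cons a l => simp [sum_range_succ', ← ih l, add_comm]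

variable {f g : ℤ → ℝ} {hf : (Function.support f).Finite} {hg : (Function.support g).Finite}

theorem sum_nthLargest (k : ℕ) :
    ∑ i ∈ Icc 1 k, nthLargest f hf i = ((sortedValues f hf).take k).sum := by
  rw [← sum_range_getD, ← Nat.Ico_zero_eq_range, sum_Ico_eq_sum_range,
    ← Ico_succ_right_eq_Icc, sum_Ico_eq_sum_range]
  simp [nthLargest]

theorem sum_map_sortedValues (φ : ℝ → ℝ) :
    ((sortedValues f hf).map φ).sum = ∑ x ∈ hf.toFinset, φ (f x) := by
  rw [← Multiset.sum_coe, ← Multiset.map_coe, sortedValues, Multiset.sort_eq, Multiset.map_map]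
  rfl

theorem sum_nthLargest_of_card_le {k : ℕ} (hk : hf.toFinset.card ≤ k) :
    ∑ i ∈ Icc 1 k, nthLargest f hf i = ∑ x ∈ hf.toFinset, f x := by
  rw [sum_nthLargest, List.take_of_length_le (by simpa [sortedValues] using hk),
    ← List.map_id (sortedValues f hf), sum_map_sortedValues]
  rfl

theorem Majorized.of_sum_posPart_sub_le (hg0 : ∀ x, 0 ≤ g x)
    (htot : ∑ x ∈ hf.toFinset, f x = ∑ x ∈ hg.toFinset, g x)
    (h : ∀ c, 0 ≤ c → ∑ x ∈ hf.toFinset, (f x - c)⁺ ≤ ∑ x ∈ hg.toFinset, (g x - c)⁺) :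
    Majorized f g := by
  refine ⟨hf, hg, fun k => ?_, ?_⟩
  · have sorted_ge : (sortedValues g hg).Pairwise (· ≥ ·) := Multiset.pairwise_sort _ _
    have sorted_nonneg : ∀ y ∈ sortedValues g hg, 0 ≤ y := by
      simp only [sortedValues, Multiset.mem_sort, Multiset.mem_map]
      rintro y ⟨x, -, rfl⟩
      exact hg0 x
    -- The bound `sum_take_le` is sharp for `g` at the threshold given by its next largest value.
    have hc : 0 ≤ (sortedValues g hg).getD k 0 := getD_of_forall_mem le_rfl sorted_nonneg k
    have hfc := sum_take_le hc (sortedValues f hf) k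
    have hgc := sum_take_of_pairwise_ge sorted_ge sorted_nonneg k
    rw [sum_map_sortedValues] at hfc hgc
    rw [sum_nthLargest, sum_nthLargest]
    linarith [h _ hc]
  · rw [sum_nthLargest_of_card_le (le_max_left _ _), sum_nthLargest_of_card_le (le_max_right _ _),
      htot]

theorem Majorized.of_substochastic (hg0 : ∀ x, 0 ≤ g x)
    (htot : ∑ x ∈ hf.toFinset, f x = ∑ x ∈ hg.toFinset, g x) {K : ℤ → ℤ → ℝ}
    (hK : ∀ r t, 0 ≤ K r t) (hrow : ∀ r, ∑ t ∈ hf.toFinset, K r t ≤ 1)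
    (hcol : ∀ t, ∑ r ∈ hg.toFinset, K r t ≤ 1)
    (hfg : ∀ t, f t = ∑ r ∈ hg.toFinset, g r * K r t) : Majorized f g := by
  refine .of_sum_posPart_sub_le hg0 htot fun c hc => ?_
  have posPart_le : ∀ t, (f t - c)⁺ ≤ ∑ r ∈ hg.toFinset, (g r - c)⁺ * K r t := by
    intro t
    refine sup_le ?_ (sum_nonneg fun r _ => mul_nonneg (posPart_nonneg _) (hK r t))
    calc f t - c ≤ f t - c * ∑ r ∈ hg.toFinset, K r t := by
          gcongr
          exact mul_le_of_le_one_right hc (hcol t)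
      _ = ∑ r ∈ hg.toFinset, (g r - c) * K r t := by
          simp only [hfg, mul_sum, ← sum_sub_distrib, sub_mul]
      _ ≤ ∑ r ∈ hg.toFinset, (g r - c)⁺ * K r t :=
          sum_le_sum fun r _ => mul_le_mul_of_nonneg_right (le_posPart _) (hK r t)
  calc ∑ t ∈ hf.toFinset, (f t - c)⁺
      ≤ ∑ t ∈ hf.toFinset, ∑ r ∈ hg.toFinset, (g r - c)⁺ * K r t :=
        sum_le_sum fun t _ => posPart_le t
    _ = ∑ r ∈ hg.toFinset, (g r - c)⁺ * ∑ t ∈ hf.toFinset, K r t := by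
        rw [sum_comm]
        simp only [mul_sum]
    _ ≤ ∑ r ∈ hg.toFinset, (g r - c)⁺ :=
        sum_le_sum fun r _ => mul_le_of_le_one_right (posPart_nonneg _) (hrow r)

end Majorization

section Squeeze

variable {f : ℤ → ℝ} {hf : (Function.support f).Finite}

theorem squeeze_natCast (r : Fin hf.toFinset.card) :
    squeeze f hf (r : ℕ) = f (hf.toFinset.orderEmbOfFin rfl r) := by
  unfold squeeze
  rw [sum_eq_single_of_mem r (mem_univ r) fun q _ hq => Set.indicator_of_notMem ?_ _]
  · simp
  · simpa [Fin.val_inj] using hq.symm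

theorem squeeze_nonneg (h0 : ∀ x, 0 ≤ f x) (k : ℤ) : 0 ≤ squeeze f hf k :=
  sum_nonneg fun _ _ => Set.indicator_nonneg (fun _ _ => h0 _) k

theorem support_squeeze : Function.support (squeeze f hf) = Set.Ico 0 (hf.toFinset.card : ℤ) := by
  ext k
  rw [Function.mem_support]
  constructor
  · intro hk
    obtain ⟨r, -, hr⟩ := exists_ne_zero_of_sum_ne_zero hk
    obtain rfl := Set.eq_of_mem_singleton (Set.mem_of_indicator_ne_zero hr)
    exact ⟨by lia, by exact_mod_cast r.2⟩
  · rintro ⟨hk0, hk⟩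
    lift k to ℕ using hk0
    have hr := squeeze_natCast (hf := hf) ⟨k, by exact_mod_cast hk⟩
    rw [hr]
    exact hf.mem_toFinset.1 (orderEmbOfFin_mem _ _ _)

theorem IsHashLogConcave.isPF2_squeeze (h : IsHashLogConcave f hf) (h0 : ∀ x, 0 ≤ f x) :
    IsPF2 (squeeze f hf) :=
  IsLogConcaveSeq.isPF2 h (squeeze_nonneg h0) (support_squeeze ▸ Set.ordConnected_Ico)

/-- The increasing enumeration `x₀ < ⋯ < xₙ` of the support of `f`, which transports the law `f^#`
back to `f`. It takes integer arguments in order to be composed with integer-valued random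
variables; only its values on `0, …, n` are meaningful. -/
noncomputable def supportPoint (f : ℤ → ℝ) (hf : (Function.support f).Finite) (i : ℤ) : ℤ :=
  if h : i.toNat < hf.toFinset.card then hf.toFinset.orderEmbOfFin rfl ⟨i.toNat, h⟩ else 0

theorem supportPoint_natCast (r : Fin hf.toFinset.card) :
    supportPoint f hf (r : ℕ) = hf.toFinset.orderEmbOfFin rfl r := by
  simp [supportPoint]

theorem strictMonoOn_supportPoint :
    StrictMonoOn (supportPoint f hf) (Function.support (squeeze f hf)) := by
  rw [support_squeeze]
  rintro i ⟨hi0, hi⟩ j ⟨hj0, hj⟩ hij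
  lift i to ℕ using hi0
  lift j to ℕ using hj0
  have hxi := supportPoint_natCast (hf := hf) ⟨i, by exact_mod_cast hi⟩
  have hxj := supportPoint_natCast (hf := hf) ⟨j, by exact_mod_cast hj⟩
  rw [hxi, hxj]
  exact (orderEmbOfFin _ _).strictMono (Fin.mk_lt_mk.2 (by exact_mod_cast hij))

theorem sum_squeeze_mul (φ : ℤ → ℝ) :
    ∑ i ∈ range hf.toFinset.card, squeeze f hf i * φ (supportPoint f hf i) =
      ∑ y ∈ hf.toFinset, f y * φ y := by
  rw [sum_range fun i : ℕ => squeeze f hf i * φ (supportPoint f hf i)]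
  simp only [squeeze_natCast, supportPoint_natCast]
  conv_rhs => rw [← map_orderEmbOfFin_univ hf.toFinset rfl, sum_map]
  rfl

end Squeeze

section MassFunction

variable {Ω : Type*} [MeasurableSpace Ω] {μ : Measure Ω}

theorem massFn_nonneg (X : Ω → ℤ) (x : ℤ) : 0 ≤ massFn μ X x :=
  measureReal_nonneg

theorem support_massFn_subset {X : Ω → ℤ} {T : Set ℤ} (h : ∀ᵐ ω ∂μ, X ω ∈ T) :
    Function.support (massFn μ X) ⊆ T := by
  intro x hx
  by_contra hxT
  refine hx ?_
  rw [massFn, measureReal_def, measure_mono_null (fun ω hω => ?_) (ae_iff.1 h), ENNReal.toReal_zero]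
  rwa [Set.mem_ofPred_eq, Set.eq_of_mem_singleton hω]

theorem massFn_eq_sub [IsFiniteMeasure μ] {X : Ω → ℤ} (hX : Measurable X) (t : ℤ) :
    massFn μ X t = μ.real (X ⁻¹' Set.Iic t) - μ.real (X ⁻¹' Set.Iic (t - 1)) := by
  rw [← measureReal_sdiff (Set.preimage_mono (Set.Iic_subset_Iic.2 (by lia)))
    (hX measurableSet_Iic), ← Set.preimage_sdiff, massFn]
  congr 2
  ext y
  simp only [Set.mem_singleton_iff, Set.Iic_sdiff_Iic, Set.mem_Ioc]
  lia

theorem ae_mem_support_massFn [IsFiniteMeasure μ] (X : Ω → ℤ) :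
    ∀ᵐ ω ∂μ, X ω ∈ Function.support (massFn μ X) := by
  have null_fiber : ∀ x, ∀ᵐ ω ∂μ, X ω = x → massFn μ X x ≠ 0 := by
    intro x
    by_cases hx : massFn μ X x = 0
    · filter_upwards [measure_eq_zero_iff_ae_notMem.1 ((measureReal_eq_zero_iff).1 hx)] with ω hω h
      exact absurd h hω
    · exact .of_forall fun _ _ => hx
  filter_upwards [ae_all_iff.2 null_fiber] with ω hω using hω _ rfl

theorem finite_support_massFn_sum [IsFiniteMeasure μ] {ι : Type*} [Fintype ι]
    {X : ι → Ω → ℤ} (hX : ∀ j, (Function.support (massFn μ (X j))).Finite) :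
    (Function.support (massFn μ (∑ j, X j))).Finite := by
  refine ((Set.Finite.pi' hX).image fun x => ∑ j, x j).subset (support_massFn_subset ?_)
  filter_upwards [ae_all_iff.2 fun j => ae_mem_support_massFn (X j)] with ω hω
  exact ⟨fun j => X j ω, hω, (sum_apply ω univ X).symm⟩

theorem measureReal_eq_sum_preimage_inter [IsFiniteMeasure μ] {X : Ω → ℤ} (hX : Measurable X)
    {E : Set Ω} {T : Finset ℤ} (hT : ∀ᵐ ω ∂μ, ω ∈ E → X ω ∈ T) :
    μ.real E = ∑ x ∈ T, μ.real (X ⁻¹' {x} ∩ E) := by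
  have inter_eq : (X ⁻¹' T ∩ E : Set Ω) =ᵐ[μ] E := by
    filter_upwards [hT] with ω hω
    exact propext ⟨fun h => h.2, fun h => ⟨hω h, h⟩⟩
  calc μ.real E = μ.real (X ⁻¹' T ∩ E) := (measureReal_congr inter_eq).symm
    _ = (μ.restrict E).real (X ⁻¹' T) := (measureReal_restrict_apply (hX .of_discrete)).symm
    _ = ∑ x ∈ T, (μ.restrict E).real (X ⁻¹' {x}) :=
        (sum_measureReal_preimage_singleton T fun x _ => hX (measurableSet_singleton x)).symm
    _ = ∑ x ∈ T, μ.real (X ⁻¹' {x} ∩ E) :=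
        sum_congr rfl fun x _ => measureReal_restrict_apply (hX (measurableSet_singleton x))

theorem sum_massFn_le_one [IsZeroOrProbabilityMeasure μ] {X : Ω → ℤ} (hX : Measurable X)
    (T : Finset ℤ) : ∑ x ∈ T, massFn μ X x ≤ 1 :=
  (sum_measureReal_preimage_singleton T fun x _ => hX (measurableSet_singleton x)).trans_le
    measureReal_le_one

theorem sum_massFn_eq_one [IsProbabilityMeasure μ] {X : Ω → ℤ} (hX : Measurable X)
    (hfin : (Function.support (massFn μ X)).Finite) :
    ∑ x ∈ hfin.toFinset, massFn μ X x = 1 := by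
  have := measureReal_eq_sum_preimage_inter hX (μ := μ) (E := Set.univ)
    (T := hfin.toFinset) (by simpa using ae_mem_support_massFn X)
  simpa [massFn] using this.symm

end MassFunction

section Ranking

variable {Ω : Type*} [MeasurableSpace Ω] {μ : Measure Ω}

theorem massFn_add [IsFiniteMeasure μ] {R Z : Ω → ℤ} (hR : Measurable R)
    (hRZ : IndepFun R Z μ) {s : ℤ} {T : Finset ℤ} (hT : ∀ᵐ ω ∂μ, R ω + Z ω = s → R ω ∈ T) :
    massFn μ (R + Z) s = ∑ r ∈ T, massFn μ R r * massFn μ Z (s - r) := by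
  rw [massFn, measureReal_eq_sum_preimage_inter (E := (R + Z) ⁻¹' {s}) hR hT]
  refine sum_congr rfl fun r _ => ?_
  have fiber_eq : R ⁻¹' {r} ∩ (R + Z) ⁻¹' {s} = R ⁻¹' {r} ∩ Z ⁻¹' {s - r} := by
    ext ω
    refine and_congr_right fun hω => ?_
    rw [Set.mem_preimage, Set.mem_singleton_iff] at hω
    simp [hω, eq_sub_iff_add_eq, add_comm]
  rw [fiber_eq, measureReal_def, hRZ.measure_inter_preimage_eq_mul _ _ (measurableSet_singleton r)
    (measurableSet_singleton _), ENNReal.toReal_mul]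
  rfl

theorem isPF2_massFn_add [IsFiniteMeasure μ] {R Z : Ω → ℤ} (hR : Measurable R)
    (hRZ : IndepFun R Z μ) (hR0 : ∀ᵐ ω ∂μ, 0 ≤ R ω) (hZ0 : ∀ᵐ ω ∂μ, 0 ≤ Z ω)
    (hRpf : IsPF2 (massFn μ R)) (hZpf : IsPF2 (massFn μ Z)) : IsPF2 (massFn μ (R + Z)) := by
  intro x x' y y' hx hy
  have massFn_sub : ∀ a b, x ≤ a → b ≤ y' → massFn μ (R + Z) (b - a) =
      ∑ u ∈ Icc x y', massFn μ R (u - a) * massFn μ Z (b - u) := by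
    intro a b ha hb
    have hT : ∀ᵐ ω ∂μ, R ω + Z ω = b - a →
        R ω ∈ (Icc x y').map (Equiv.subRight a).toEmbedding := by
      filter_upwards [hR0, hZ0] with ω hRω hZω h
      simp only [mem_map_equiv, Equiv.subRight_symm_apply, mem_Icc]
      lia
    simp [massFn_add hR hRZ hT]
  simp only [massFn_sub _ _ le_rfl le_rfl, massFn_sub _ _ hx le_rfl, massFn_sub _ _ le_rfl hy,
    massFn_sub _ _ hx hy]
  exact hRpf.sum_mul hZpf (Icc x y') hx hy

/-- The conditional distribution function `t ↦ ℙ(S ≤ t | R = r)`. -/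
noncomputable def cdfGiven (μ : Measure Ω) (R S : Ω → ℤ) (r t : ℤ) : ℝ :=
  μ[|R ← r].real (S ⁻¹' Set.Iic t)

theorem cdfGiven_mono (R S : Ω → ℤ) (r : ℤ) : Monotone (cdfGiven μ R S r) :=
  fun _ _ h => measureReal_mono (Set.preimage_mono (Set.Iic_subset_Iic.2 h))

theorem massFn_mul_cond [IsFiniteMeasure μ] {R : Ω → ℤ} (hR : Measurable R) (r : ℤ) (E : Set Ω) :
    massFn μ R r * μ[|R ← r].real E = μ.real (R ⁻¹' {r} ∩ E) := by
  rw [massFn, measureReal_def, measureReal_def, measureReal_def, ← ENNReal.toReal_mul, mul_comm,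
    cond_mul_eq_inter (hR (measurableSet_singleton r))]

theorem massFn_mul_cdfGiven_add [IsFiniteMeasure μ] {R S Z : Ω → ℤ} (hR : Measurable R)
    (hZ : Measurable Z) (hRSZ : IndepFun (fun ω => (R ω, S ω)) Z μ) (x : ℤ → ℤ) {s : ℤ} (t : ℤ)
    {T : Finset ℤ} (hT : ∀ᵐ ω ∂μ, R ω + Z ω = s → R ω ∈ T) :
    massFn μ (R + Z) s * cdfGiven μ (R + Z) (S + x ∘ Z) s t =
      ∑ r ∈ T, massFn μ R r * massFn μ Z (s - r) * cdfGiven μ R S r (t - x (s - r)) := by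
  rw [cdfGiven, massFn_mul_cond (hR.add hZ),
    measureReal_eq_sum_preimage_inter hR (hT.mono fun ω h hω => h hω.1)]
  refine sum_congr rfl fun r _ => ?_
  have fiber_eq : R ⁻¹' {r} ∩ ((R + Z) ⁻¹' {s} ∩ (S + x ∘ Z) ⁻¹' Set.Iic t) =
      (fun ω => (R ω, S ω)) ⁻¹' ({r} ×ˢ Set.Iic (t - x (s - r))) ∩ Z ⁻¹' {s - r} := by
    ext ω
    simp only [Set.mem_inter_iff, Set.mem_preimage, Set.mem_singleton_iff, Pi.add_apply,
      Function.comp_apply, Set.mem_Iic, Set.mem_prod]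
    grind
  rw [fiber_eq, measureReal_def, hRSZ.measure_inter_preimage_eq_mul _ _ .of_discrete .of_discrete,
    ENNReal.toReal_mul, mul_right_comm, cdfGiven, massFn_mul_cond hR]
  rfl

/-- The random variable `R ≥ 0` ranks the values of `S`: raising the value of `R` by one moves the
conditional law of `S` to the right by at least one, in the sense of stochastic order. Together
with the log-concavity of the law of `R`, this property is preserved by independent sums. -/
structure IsRanking (μ : Measure Ω) (R S : Ω → ℤ) : Prop where
  nonneg : ∀ᵐ ω ∂μ, 0 ≤ R ω
  isPF2 : IsPF2 (massFn μ R)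
  cdfGiven_add_one_le : ∀ r t, massFn μ R r ≠ 0 → massFn μ R (r + 1) ≠ 0 →
    cdfGiven μ R S (r + 1) (t + 1) ≤ cdfGiven μ R S r t

theorem IsRanking.zero (S : Ω → ℤ) : IsRanking μ 0 S := by
  have hsupp : ∀ r, massFn μ (0 : Ω → ℤ) r ≠ 0 → r = 0 := fun _ hr =>
    support_massFn_subset (T := {0}) (.of_forall fun _ => rfl) hr
  refine ⟨.of_forall fun _ => le_rfl, ?_, fun r t hr hr' => ?_⟩
  · intro x x' y y' hx hy
    rcases eq_or_ne (massFn μ 0 (y' - x) * massFn μ 0 (y - x')) 0 with h | h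
    · exact h.trans_le (mul_nonneg (massFn_nonneg _ _) (massFn_nonneg _ _))
    · have hy'x := hsupp _ (left_ne_zero_of_mul h)
      have hyx' := hsupp _ (right_ne_zero_of_mul h)
      obtain rfl : y = y' := by lia
      obtain rfl : x = x' := by lia
      exact le_rfl
  · have := hsupp _ hr
    have := hsupp _ hr'
    lia

theorem IsRanking.cdfGiven_add_one_le_add [IsFiniteMeasure μ] {R S Z : Ω → ℤ} (h : IsRanking μ R S)
    (hR : Measurable R) (hZ : Measurable Z) (hRSZ : IndepFun (fun ω => (R ω, S ω)) Z μ)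
    (hZ0 : ∀ᵐ ω ∂μ, 0 ≤ Z ω) (hZpf : IsPF2 (massFn μ Z)) {x : ℤ → ℤ}
    (hx : StrictMonoOn x (Function.support (massFn μ Z))) (s : ℕ) (t : ℤ)
    (hs : massFn μ (R + Z) s ≠ 0) (hs' : massFn μ (R + Z) (s + 1) ≠ 0) :
    cdfGiven μ (R + Z) (S + x ∘ Z) (s + 1) (t + 1) ≤ cdfGiven μ (R + Z) (S + x ∘ Z) s t := by
  have hRZ : IndepFun R Z μ := hRSZ.comp measurable_fst measurable_id
  have range_cover : ∀ n : ℕ, ∀ᵐ ω ∂μ, R ω + Z ω = n →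
      R ω ∈ (range (n + 1)).map Nat.castEmbedding := by
    intro n
    filter_upwards [h.nonneg, hZ0] with ω hRω hZω hω
    simp only [mem_map, mem_range, Nat.castEmbedding_apply]
    exact ⟨(R ω).toNat, by lia, by lia⟩
  have massFn_eq : ∀ n : ℕ, massFn μ (R + Z) n =
      ∑ r ∈ range (n + 1), massFn μ R r * massFn μ Z (n - r) := by
    intro n
    rw [massFn_add hR hRZ (range_cover n), sum_map]
    rfl
  have massFn_mul_cdfGiven : ∀ (n : ℕ) (k : ℤ),
      massFn μ (R + Z) n * cdfGiven μ (R + Z) (S + x ∘ Z) n k =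
        ∑ r ∈ range (n + 1),
          massFn μ R r * massFn μ Z (n - r) * cdfGiven μ R S r (k - x (n - r)) := by
    intro n k
    rw [massFn_mul_cdfGiven_add hR hZ hRSZ x k (range_cover n), sum_map]
    rfl
  have key := h.isPF2.sum_conv_mul_le hZpf (massFn_nonneg R) (massFn_nonneg Z) (cdfGiven_mono R S)
    h.cdfGiven_add_one_le hx s t (s + 1)
  rw [← Nat.cast_add_one] at hs' key ⊢
  rw [← massFn_eq, ← massFn_eq, ← massFn_mul_cdfGiven, ← massFn_mul_cdfGiven] at key
  have hs_pos := (massFn_nonneg _ _).lt_of_ne' hs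
  have hs'_pos := (massFn_nonneg _ _).lt_of_ne' hs'
  refine le_of_mul_le_mul_left ?_ (mul_pos hs_pos hs'_pos)
  linarith

theorem IsRanking.add [IsFiniteMeasure μ] {R S Z : Ω → ℤ} (h : IsRanking μ R S)
    (hR : Measurable R) (hZ : Measurable Z) (hRSZ : IndepFun (fun ω => (R ω, S ω)) Z μ)
    (hZ0 : ∀ᵐ ω ∂μ, 0 ≤ Z ω) (hZpf : IsPF2 (massFn μ Z)) {x : ℤ → ℤ}
    (hx : StrictMonoOn x (Function.support (massFn μ Z))) :
    IsRanking μ (R + Z) (S + x ∘ Z) := by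
  have nonneg : ∀ᵐ ω ∂μ, 0 ≤ (R + Z) ω := by
    filter_upwards [h.nonneg, hZ0] with ω hRω hZω using add_nonneg hRω hZω
  refine ⟨nonneg, isPF2_massFn_add hR (hRSZ.comp measurable_fst measurable_id) h.nonneg hZ0
    h.isPF2 hZpf, fun s t hs hs' => ?_⟩
  lift s to ℕ using support_massFn_subset (T := Set.Ici 0) nonneg hs
  exact h.cdfGiven_add_one_le_add hR hZ hRSZ hZ0 hZpf hx s t hs hs'

theorem IsRanking.sum {ι : Type*} {Y : ι → Ω → ℤ}
    (hY : ∀ j, Measurable (Y j)) (hind : iIndepFun Y μ) (hY0 : ∀ j, ∀ᵐ ω ∂μ, 0 ≤ Y j ω)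
    (hpf : ∀ j, IsPF2 (massFn μ (Y j))) {x : ι → ℤ → ℤ}
    (hx : ∀ j, StrictMonoOn (x j) (Function.support (massFn μ (Y j)))) (s : Finset ι) :
    IsRanking μ (∑ j ∈ s, Y j) (∑ j ∈ s, x j ∘ Y j) := by
  classical
  have := hind.isProbabilityMeasure
  induction s using Finset.induction_on with
  | empty => simpa using IsRanking.zero 0
  | insert j s hj ih =>
    have hRSZ : IndepFun (fun ω => ((∑ i ∈ s, Y i) ω, (∑ i ∈ s, x i ∘ Y i) ω)) (Y j) μ := by
      have hind_pairs : iIndepFun (fun i => (fun y => (y, x i y)) ∘ Y i) μ :=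
        hind.comp _ fun _ => .of_discrete
      have hpairs := hind_pairs.indepFun_finsetSum_of_notMem
        (fun i => Measurable.of_discrete.comp (hY i)) hj
      convert hpairs.comp measurable_id measurable_fst using 1
      · ext ω <;> simp [Prod.fst_sum, Prod.snd_sum]
      · rfl
    rw [sum_insert hj, sum_insert hj, add_comm, add_comm (x j ∘ Y j)]
    have hsum : Measurable (∑ i ∈ s, Y i) :=
      sum_induction _ Measurable (fun _ _ => .add) measurable_zero fun i _ => hY i
    exact ih.add hsum (hY j) hRSZ (hY0 j) (hpf j) (hx j)

theorem IsRanking.cdfGiven_le_of_lt {R S : Ω → ℤ} (h : IsRanking μ R S) {r r' : ℤ}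
    (hr : massFn μ R r ≠ 0) (hr' : massFn μ R r' ≠ 0) (hrr' : r < r') (t : ℤ) :
    cdfGiven μ R S r' t ≤ cdfGiven μ R S r (t - 1) := by
  have hconn := h.isPF2.ordConnected_support (massFn_nonneg R)
  induction r', Int.add_one_le_iff.2 hrr' using Int.leInduction with
  | base => simpa using h.cdfGiven_add_one_le r (t - 1) hr hr'
  | succ r' hle ih =>
    have hmid : massFn μ R r' ≠ 0 := hconn.out hr hr' ⟨by lia, by lia⟩
    calc cdfGiven μ R S (r' + 1) t ≤ cdfGiven μ R S r' (t - 1) := by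
          simpa using h.cdfGiven_add_one_le r' (t - 1) hmid hr'
      _ ≤ cdfGiven μ R S r' t := cdfGiven_mono R S r' (by lia)
      _ ≤ cdfGiven μ R S r (t - 1) := ih hmid (by lia)

theorem IsRanking.majorized [IsProbabilityMeasure μ] {R S : Ω → ℤ} (h : IsRanking μ R S)
    (hR : Measurable R) (hS : Measurable S) (hRfin : (Function.support (massFn μ R)).Finite)
    (hSfin : (Function.support (massFn μ S)).Finite) : Majorized (massFn μ S) (massFn μ R) := by
  have htot : ∑ t ∈ hSfin.toFinset, massFn μ S t = ∑ r ∈ hRfin.toFinset, massFn μ R r :=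
    (sum_massFn_eq_one hS hSfin).trans (sum_massFn_eq_one hR hRfin).symm
  refine .of_substochastic (massFn_nonneg R) htot (K := fun r => massFn μ[|R ← r] S)
    (fun _ => massFn_nonneg S) (fun r => sum_massFn_le_one hS _) (fun t => ?_) fun t => ?_
  · simp only [massFn_eq_sub hS]
    refine (sum_sub_le_of_disjoint_intervals _ zero_le_one (fun _ _ => measureReal_nonneg)
      (fun _ _ => measureReal_le_one) fun r hr r' hr' hrr' => ?_).trans_eq (sub_zero 1)
    exact h.cdfGiven_le_of_lt (hRfin.mem_toFinset.1 hr) (hRfin.mem_toFinset.1 hr') hrr' t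
  · have hT : ∀ᵐ ω ∂μ, ω ∈ S ⁻¹' {t} → R ω ∈ hRfin.toFinset := by
      filter_upwards [ae_mem_support_massFn R] with ω hω _ using hRfin.mem_toFinset.2 hω
    rw [massFn, measureReal_eq_sum_preimage_inter hR hT]
    exact sum_congr rfl fun r _ => (massFn_mul_cond hR r _).symm

end Ranking

section Transport

theorem massFn_supportPoint_comp {Ω : Type*} [MeasurableSpace Ω] {ν : Measure Ω}
    [IsFiniteMeasure ν] {f : ℤ → ℝ} {hf : (Function.support f).Finite} {Y : Ω → ℤ}
    (hY : Measurable Y) (hlaw : massFn ν Y = squeeze f hf) :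
    massFn ν (supportPoint f hf ∘ Y) = f := by
  ext y
  have hT : ∀ᵐ ω ∂ν, ω ∈ (supportPoint f hf ∘ Y) ⁻¹' {y} →
      Y ω ∈ (range hf.toFinset.card).map Nat.castEmbedding := by
    filter_upwards [ae_mem_support_massFn Y] with ω hω _
    rw [hlaw, support_squeeze] at hω
    simp only [mem_map, mem_range, Nat.castEmbedding_apply]
    exact ⟨(Y ω).toNat, by have := hω.1; have := hω.2; lia, by have := hω.1; lia⟩
  have fiber : ∀ i : ℕ, ν.real (Y ⁻¹' {(i : ℤ)} ∩ (supportPoint f hf ∘ Y) ⁻¹' {y}) =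
      squeeze f hf i * if supportPoint f hf i = y then 1 else 0 := by
    intro i
    rw [← hlaw, massFn]
    split_ifs with h
    · rw [mul_one, Set.inter_eq_left.2 fun ω hω => ?_]
      rw [Set.mem_preimage, Function.comp_apply, Set.eq_of_mem_singleton hω]
      exact h
    · rw [mul_zero, Set.disjoint_iff_inter_eq_empty.1, measureReal_empty]
      refine Set.disjoint_left.2 fun ω hω hω' => h ?_
      rwa [← Set.eq_of_mem_singleton hω]
  rw [massFn, measureReal_eq_sum_preimage_inter hY hT, sum_map]
  simp only [Nat.castEmbedding_apply, fiber]
  rw [sum_squeeze_mul (fun z => if z = y then 1 else 0)]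
  simp only [mul_ite, mul_one, mul_zero, sum_ite_eq', hf.mem_toFinset, Function.mem_support,
    ite_not]
  exact ite_eq_right_iff.2 Eq.symm

theorem identDistrib_of_massFn_eq {Ω Ω' : Type*} [MeasurableSpace Ω] [MeasurableSpace Ω']
    {μ : Measure Ω} {ν : Measure Ω'} [IsFiniteMeasure μ] [IsFiniteMeasure ν] {X : Ω → ℤ}
    {Y : Ω' → ℤ} (hX : Measurable X) (hY : Measurable Y) (h : massFn μ X = massFn ν Y) :
    IdentDistrib X Y μ ν := by
  refine ⟨hX.aemeasurable, hY.aemeasurable, Measure.ext_of_measureReal_singleton fun x => ?_⟩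
  rw [map_measureReal_apply hX (measurableSet_singleton x),
    map_measureReal_apply hY (measurableSet_singleton x)]
  exact congrFun h x

theorem massFn_sum_eq_of_iIndepFun {Ω Ω' ι : Type*} [Fintype ι] [MeasurableSpace Ω]
    [MeasurableSpace Ω'] {μ : Measure Ω} {ν : Measure Ω'} {X : ι → Ω → ℤ} {Y : ι → Ω' → ℤ}
    (hX : ∀ j, Measurable (X j)) (hY : ∀ j, Measurable (Y j)) (hXind : iIndepFun X μ)
    (hYind : iIndepFun Y ν) (hlaw : ∀ j, massFn μ (X j) = massFn ν (Y j)) :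
    massFn μ (∑ j, X j) = massFn ν (∑ j, Y j) := by
  have := hXind.isProbabilityMeasure
  have := hYind.isProbabilityMeasure
  have hident := IdentDistrib.pi (fun j => identDistrib_of_massFn_eq (hX j) (hY j) (hlaw j))
    hXind hYind
  have hsum : IdentDistrib (∑ j, X j) (∑ j, Y j) μ ν := by
    convert hident.comp (u := fun x : ι → ℤ => ∑ j, x j) .of_discrete using 1 <;> ext <;> simp
  ext x
  exact congrArg ENNReal.toReal (hsum.measure_mem_eq (measurableSet_singleton x))

end Transport

theorem theorem1 {Ω Ω' : Type*} [MeasurableSpace Ω] [MeasurableSpace Ω']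
    (μ : MeasureTheory.Measure Ω) [MeasureTheory.IsProbabilityMeasure μ]
    (ν : MeasureTheory.Measure Ω') [MeasureTheory.IsProbabilityMeasure ν]
    (N : ℕ)
    (X : Fin N → Ω → ℤ) (hX : ∀ j, Measurable (X j))
    (hXindep : ProbabilityTheory.iIndepFun X μ)
    (hXfin : ∀ j, (Function.support (massFn μ (X j))).Finite)
    (hXlc : ∀ j, IsHashLogConcave (massFn μ (X j)) (hXfin j))
    (Xhash : Fin N → Ω' → ℤ) (hXhash : ∀ j, Measurable (Xhash j))
    (hXhashIndep : ProbabilityTheory.iIndepFun Xhash ν)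
    (hXhashLaw : ∀ j, massFn ν (Xhash j) = squeeze (massFn μ (X j)) (hXfin j)) :
    Majorized (massFn μ (fun ω => ∑ j, X j ω)) (massFn ν (fun ω => ∑ j, Xhash j ω)) := by
  have hY0 : ∀ j, ∀ᵐ ω ∂ν, 0 ≤ Xhash j ω := by
    intro j
    filter_upwards [ae_mem_support_massFn (μ := ν) (Xhash j)] with ω hω
    rw [hXhashLaw j, support_squeeze] at hω
    exact hω.1
  let S : Fin N → Ω' → ℤ := fun j => supportPoint (massFn μ (X j)) (hXfin j) ∘ Xhash j
  have hS : ∀ j, Measurable (S j) := fun j => Measurable.of_discrete.comp (hXhash j)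
  have hSlaw : ∀ j, massFn ν (S j) = massFn μ (X j) := fun j =>
    massFn_supportPoint_comp (hXhash j) (hXhashLaw j)
  have hranking : IsRanking ν (∑ j, Xhash j) (∑ j, S j) :=
    .sum hXhash hXhashIndep hY0 (fun j => hXhashLaw j ▸ (hXlc j).isPF2_squeeze (massFn_nonneg _))
      (fun j => hXhashLaw j ▸ strictMonoOn_supportPoint) univ
  have hsum : massFn μ (∑ j, X j) = massFn ν (∑ j, S j) :=
    massFn_sum_eq_of_iIndepFun hX hS hXindep (hXhashIndep.comp _ fun _ => .of_discrete)
      fun j => (hSlaw j).symm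
  have hSfin : ∀ j, (Function.support (massFn ν (S j))).Finite := fun j => hSlaw j ▸ hXfin j
  have hYfin : ∀ j, (Function.support (massFn ν (Xhash j))).Finite := fun j => by
    rw [hXhashLaw j, support_squeeze]
    exact Set.finite_Ico _ _
  have hmajorized : Majorized (massFn μ (∑ j, X j)) (massFn ν (∑ j, Xhash j)) :=
    hsum ▸ hranking.majorized (by fun_prop) (by fun_prop) (finite_support_massFn_sum hYfin)
      (finite_support_massFn_sum hSfin)
  simpa only [Finset.sum_fn] using hmajorized
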